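/- Let $\overline{\mathbb{Q}}$ be a fixed algebraic closure of $\mathbb{Q}$ and $h$ the absolute logarithmic Weil height on it. A subset $A\subseteq\overline{\mathbb{Q}}$ has property (N) if $\{x\in A: h(x)<T\}$ is finite for every $T>0$. Let $K$ be a field and $\overline K$ an algebraic closure of $K$. A polynomial mapping $f=(f_1,\dots,f_n):K^n\to K^n$ is called admissible if every $f_i$ has degree at least $2$ and the leading forms (homogeneous parts of highest degree) of $f_1,\dots,f_n$ have no nontrivial common zero in $\overline K^n$. One says that $K$ has property * (SP) if for every $n\ge 1$ and every admissible $f:K^n\to K^n$, every $X\subseteq K^n$ with $f(X)=X$ is finite; * (P) if this holds for $n=1$; * (K) if for every $n\ge1$, every admissible $\Phi:K^n\to K^n$ and every polynomial mapping $\Psi:K^n\to K^n$ such that the minimum of the degrees of the polynomials defining $\Phi$ is larger than the maximum of the degrees of the polynomials defining $\Psi$, every $X\subseteq K^n$ with $\Psi(X)\subseteq\Phi(X)$ and $\Psi|_X$ injective is finite; * ($\overline{\mathrm P}$) if for every $f\in\overline K[x]$ of degree at least $2$, every set $X\subseteq\overline K$ of elements of uniformly bounded degree over $K$ with $X\subseteq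 f(X)$ is finite; * (R) if every rational function $f\in K(x)$ for which there is an infinite set $X\subseteq K$, containing no pole of $f$, with $f(X)=X$ is of the form $(\alpha x+\beta)/(\gamma x+\delta)$ with $\alpha,\beta,\gamma,\delta\in K$. Then none of the properties (N), (K), (SP), ($\overline{\mathrm P}$), (R), (P) is in general preserved under taking the compositum of two subfields of $\overline{\mathbb{Q}}$. More precisely, there exist subfields $L_1,L_2\subseteq\overline{\mathbb{Q}}$, each having all six properties (N), (K), (SP), ($\overline{\mathrm P}$), (R), (P), such that the compositum $L_1L_2$ contains infinitely many roots of unity, the map $x\mapsto x^2$ has infinitely many preperiodic points in $L_1L_2$, and $L_1L_2$ has none of the six properties. -/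

import Mathlib

/-- The fixed algebraic closure of the field of rational numbers. -/
abbrev Qbar : Type := AlgebraicClosure ℚ

/-- Property (N) for a set of algebraic numbers: for every `T > 0` it has only finitely many
elements whose absolute logarithmic Weil height is less than `T`. -/
def PropertyN (A : Set Qbar) : Prop :=
  ∀ T : ℝ, 0 < T → {x : Qbar | x ∈ A ∧ NumberField.absLogHeight₁ x < T}.Finite

/-- The polynomial mapping `K^n → K^n` given by an `n`-tuple of polynomials in `n` variables. -/
noncomputable def polyMap {K : Type*} [Field K] {n : ℕ} (f : Fin n → MvPolynomial (Fin n) K)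
    (x : Fin n → K) : Fin n → K :=
  fun i => MvPolynomial.eval x (f i)

/-- The leading form of a polynomial: its homogeneous part of highest degree. -/
noncomputable def leadingForm {K : Type*} [Field K] {n : ℕ} (p : MvPolynomial (Fin n) K) :
    MvPolynomial (Fin n) K :=
  MvPolynomial.homogeneousComponent p.totalDegree p

/-- A polynomial mapping is admissible if none of the polynomials is linear (constants count as
linear) and the leading forms have no nontrivial common zero in the algebraic closure. -/
def IsAdmissible {K : Type*} [Field K] {n : ℕ} (f : Fin n → MvPolynomial (Fin n) K) : Prop :=
  (∀ i, 2 ≤ (f i).totalDegree) ∧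
    ∀ y : Fin n → AlgebraicClosure K,
      (∀ i, MvPolynomial.aeval y (leadingForm (f i)) = 0) → y = 0

/-- The implication defining property (SP), for one fixed dimension `n`. -/
def PropertySPInDim (K : Type*) [Field K] (n : ℕ) : Prop :=
  ∀ f : Fin n → MvPolynomial (Fin n) K, IsAdmissible f →
    ∀ X : Set (Fin n → K), polyMap f '' X = X → X.Finite

/-- Property (SP). -/
def PropertySP (K : Type*) [Field K] : Prop :=
  ∀ n : ℕ, 1 ≤ n → PropertySPInDim K n

/-- Property (P): the case `n = 1` of property (SP). -/
def PropertyP (K : Type*) [Field K] : Prop :=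
  PropertySPInDim K 1

/-- Property (K). The condition on `Φ i` and `Ψ j` says that the minimum of the degrees of the
polynomials defining `Φ` exceeds the maximum of the degrees of those defining `Ψ`. -/
def PropertyK (K : Type*) [Field K] : Prop :=
  ∀ n : ℕ, 1 ≤ n → ∀ Φ Ψ : Fin n → MvPolynomial (Fin n) K, IsAdmissible Φ →
    (∀ i j, (Ψ j).totalDegree < (Φ i).totalDegree) →
    ∀ X : Set (Fin n → K), polyMap Ψ '' X ⊆ polyMap Φ '' X → Set.InjOn (polyMap Ψ) X → X.Finite

/-- Property (P-bar), in Liardet's form. -/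
def PropertyPbar (K : Type*) [Field K] : Prop :=
  ∀ f : Polynomial (AlgebraicClosure K), 2 ≤ f.natDegree →
    ∀ X : Set (AlgebraicClosure K),
      (∃ D : ℕ, ∀ x ∈ X, (minpoly K x).natDegree ≤ D) →
      X ⊆ (fun x => f.eval x) '' X → X.Finite

/-- Property (R). Since `f(X) = X` is a subset of `K`, no element of `X` is a pole of `f`. -/
def PropertyR (K : Type*) [Field K] : Prop :=
  ∀ f : RatFunc K,
    (∃ X : Set K, X.Infinite ∧ (∀ x ∈ X, f.denom.eval x ≠ 0) ∧
      (fun x => f.eval (RingHom.id K) x) '' X = X) →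
    ∃ α β γ δ : K, (γ ≠ 0 ∨ δ ≠ 0) ∧
      f = (RatFunc.C α * RatFunc.X + RatFunc.C β) / (RatFunc.C γ * RatFunc.X + RatFunc.C δ)

/-- The point `x` is preperiodic for `f`: its forward orbit is eventually periodic. -/
def IsPreperiodicPt {S : Type*} (f : S → S) (x : S) : Prop :=
  ∃ m n : ℕ, m < n ∧ f^[m] x = f^[n] x

/-! Everything positive follows from (N). A polynomial map with nondegenerate leading forms of
degree at least `m` multiplies heights by at least `m`, up to a bounded error
(`exists_mul_tupleHeight_le`, from the Nullstellensatz), so choosing preimages inside an infinite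
invariant set would give an injective self-map that contracts heights. `finite_of_contracting` rules
this out when sets of bounded height are finite. This yields (K), (R) and, after extending (N) to
elements of bounded degree, ($\overline{\mathrm P}$); (SP) and (P) are special cases of (K).

The two fields are unions of towers of number fields built in parallel. Given stages $K_1, K_2$, a
prime $d$ and a bound $T$, all but finitely many primes $p$ have the property that adjoining any
$d$-th root of $p$ to $K_1$ or $K_2$ creates no new element of height below $T$
(`finite_primes_with_small_height`). For one such $p$, adjoin $u$ to $K_1$ and $\zeta u$ to $K_2$,
where $u^d=p$ and $\zeta$ is a primitive $d$-th root of unity. Letting $T$ and $d$ grow gives (N)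
for both unions, while the compositum contains each quotient $\zeta$.

In the compositum, the infinitely many roots of unity of odd order have height $0$ and are permuted
by squaring, which defeats all six properties. -/

section

open NumberField Height

/-! ### Heights under extension of number fields. -/

theorem prod_embeddings_eq_prod_infinitePlace (K : Type*) [Field K] [NumberField K]
    (F : InfinitePlace K → ℝ) :
    ∏ φ : K →+* ℂ, F (.mk φ) = ∏ v : InfinitePlace K, F v ^ v.mult := by
  classical
  rw [← Finset.prod_fiberwise Finset.univ InfinitePlace.mk]
  refine Finset.prod_congr rfl fun v _ => ?_
  rw [← InfinitePlace.card_filter_mk_eq, Finset.prod_congr rfl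
    (g := fun _ => F v) (fun φ hφ => by rw [(Finset.mem_filter.1 hφ).2]), Finset.prod_const]

theorem prod_embeddings_comp_algebraMap (K L : Type*) [Field K] [NumberField K] [Field L] [NumberField L]
    [Algebra K L] (g : (K →+* ℂ) → ℝ) :
    ∏ ψ : L →+* ℂ, g (ψ.comp (algebraMap K L)) = (∏ φ : K →+* ℂ, g φ) ^ Module.finrank K L := by
  classical
  rw [← Finset.prod_fiberwise Finset.univ (fun ψ : L →+* ℂ => ψ.comp (algebraMap K L)),
    ← Finset.prod_pow]
  refine Finset.prod_congr rfl fun φ _ => ?_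
  rw [Finset.prod_congr rfl (g := fun _ => g φ) (fun ψ hψ => by rw [(Finset.mem_filter.1 hψ).2]),
    Finset.prod_const]
  congr 1
  let := φ.toAlgebra
  have : FiniteDimensional K L := Module.Finite.of_restrictScalars_finite ℚ K L
  rw [← AlgHom.card K L ℂ, ← Fintype.card_subtype]
  refine Fintype.card_congr
    { toFun := fun ψ => { ψ.1 with commutes' := fun a => congrArg (fun f : K →+* ℂ => f a) ψ.2 }
      invFun := fun ψ => ⟨ψ.toRingHom, ψ.comp_algebraMap⟩
      left_inv := fun _ => rfl
      right_inv := fun _ => rfl }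

/-- For integral coordinates the finite places contribute exactly the inverse norm of the ideal
generated. This leaves embeddings and ideal norms, whose behaviour under field extension is known.
-/
theorem mulHeight_mul_absNorm_span (K : Type*) [Field K] [NumberField K] {ι : Type*} [Finite ι]
    {x : ι → 𝓞 K} (hx : x ≠ 0) :
    mulHeight (fun i => (x i : K)) * (Ideal.span (Set.range x)).absNorm =
      ∏ φ : K →+* ℂ, ⨆ i, ‖φ (x i)‖ := by
  have h0 : (fun i => (x i : K)) ≠ 0 := fun h => hx <| funext fun i =>
    RingOfIntegers.ext (by simpa using congrFun h i)
  rw [NumberField.mulHeight_eq h0, mul_assoc, mul_comm (finprod _),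
    absNorm_mul_finprod_finitePlace_eq_one hx, mul_one,
    ← prod_embeddings_eq_prod_infinitePlace K fun v => ⨆ i, v (x i)]
  rfl

/-- After clearing denominators, both the product over embeddings and the ideal norm are raised to
the power $[L:K]$, hence so is their quotient. -/
theorem mulHeight_algebraMap (K L : Type*) [Field K] [NumberField K] [Field L] [NumberField L]
    [Algebra K L] {ι : Type*} [Finite ι] (x : ι → K) :
    mulHeight (fun i => algebraMap K L (x i)) = mulHeight x ^ Module.finrank K L := by
  rcases eq_or_ne x 0 with rfl | hx
  · simp
  obtain ⟨b, hb⟩ := IsLocalization.exist_integer_multiples_of_finite (nonZeroDivisors (𝓞 K)) x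
  choose y hy using hb
  have hb0 : (algebraMap (𝓞 K) K b) ≠ 0 := by
    simp
  have hy' : (fun i => (y i : K)) = (algebraMap (𝓞 K) K b) • x := by
    ext i
    rw [Pi.smul_apply, smul_eq_mul, ← Algebra.smul_def]
    exact hy i
  have hy0 : y ≠ 0 := by
    rintro rfl
    refine hx ?_
    have : (algebraMap (𝓞 K) K b) • x = 0 := by rw [← hy']; ext; simp
    exact (smul_eq_zero.1 this).resolve_left hb0
  have hL : (fun i => algebraMap K L (y i)) =
      algebraMap K L (algebraMap (𝓞 K) K b) • fun i => algebraMap K L (x i) := by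
    ext i
    simpa using congrArg (algebraMap K L) (congrFun hy' i)
  rw [← mulHeight_smul_eq_mulHeight x hb0, ← hy',
    ← mulHeight_smul_eq_mulHeight (fun i => algebraMap K L (x i))
      ((map_ne_zero (algebraMap K L)).2 hb0), ← hL]
  have h1 := mulHeight_mul_absNorm_span K hy0
  let z : ι → 𝓞 L := fun i => algebraMap (𝓞 K) (𝓞 L) (y i)
  have hz0 : z ≠ 0 := by
    intro h
    refine hy0 (funext fun i => ?_)
    exact (FaithfulSMul.algebraMap_injective (𝓞 K) (𝓞 L)) (by simpa [z] using congrFun h i)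
  have h2 := mulHeight_mul_absNorm_span L hz0
  have hspan : Ideal.span (Set.range z) =
      (Ideal.span (Set.range y)).map (algebraMap (𝓞 K) (𝓞 L)) := by
    rw [Ideal.map_span, ← Set.range_comp]; rfl
  have hz (i : ι) : ((z i : 𝓞 L) : L) = algebraMap K L (y i) := rfl
  have hfr : Module.finrank (𝓞 K) (𝓞 L) = Module.finrank K L := by
    exact (IsFractionRing.finrank_eq (𝓞 K) K (𝓞 L) L).symm
  rw [hspan, Ideal.absNorm_algebraMap, hfr] at h2
  simp only [hz] at h2
  have h3 := prod_embeddings_comp_algebraMap K L fun φ => ⨆ i, ‖φ (y i)‖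
  simp only [RingHom.comp_apply] at h3
  rw [h3, ← h1, mul_pow, Nat.cast_pow] at h2
  have h4 : ((Ideal.span (Set.range y)).absNorm : ℝ) ≠ 0 := by
    have : Ideal.span (Set.range y) ≠ ⊥ := by
      rw [Ne, Ideal.span_eq_bot]
      intro h
      exact hy0 (funext fun i => h _ ⟨i, rfl⟩)
    exact_mod_cast mt Ideal.absNorm_eq_zero_iff.1 this
  exact mul_right_cancel₀ (pow_ne_zero _ h4) h2

theorem logHeight_map_div_finrank {K L : Type*} [Field K] [NumberField K] [Field L] [NumberField L]
    (f : K →+* L) {ι : Type*} [Finite ι] (x : ι → K) :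
    logHeight (fun i => f (x i)) / Module.finrank ℚ L = logHeight x / Module.finrank ℚ K := by
  let := f.toAlgebra
  have h := mulHeight_algebraMap K L x
  have hK : (Module.finrank ℚ K : ℝ) ≠ 0 := by exact_mod_cast Module.finrank_pos.ne'
  have hKL : (Module.finrank K L : ℝ) ≠ 0 := by
    have : FiniteDimensional K L := Module.Finite.of_restrictScalars_finite ℚ K L
    exact_mod_cast Module.finrank_pos.ne'
  have hL : (Module.finrank ℚ L : ℝ) = Module.finrank ℚ K * Module.finrank K L := by
    exact_mod_cast (Module.finrank_mul_finrank ℚ K L).symm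
  have h' : logHeight (fun i => f (x i)) = Module.finrank K L * logHeight x := by
    rw [logHeight, logHeight, ← Real.log_pow, ← h]; rfl
  rw [h', hL]
  field_simp

/-! ### The absolute height of tuples of algebraic numbers. -/

instance isAlgebraic_Qbar : Algebra.IsAlgebraic ℚ Qbar := by
  have h := AlgebraicClosure.isAlgebraic ℚ
  convert! h

instance finiteDimensional_adjoin_range {ι : Type*} [Finite ι] (x : ι → Qbar) :
    FiniteDimensional ℚ (IntermediateField.adjoin ℚ (Set.range x)) :=
  have := (Set.finite_range x).to_subtype
  IntermediateField.finiteDimensional_adjoin fun y _ => Algebra.IsIntegral.isIntegral y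

/-- The absolute logarithmic height of a tuple of algebraic numbers, seen as homogeneous
coordinates of a point of projective space. -/
noncomputable def tupleHeight {ι : Type*} [Finite ι] (x : ι → Qbar) : ℝ :=
  have : NumberField (IntermediateField.adjoin ℚ (Set.range x)) := {}
  logHeight (fun i => (⟨x i, IntermediateField.subset_adjoin _ _ ⟨i, rfl⟩⟩ :
    IntermediateField.adjoin ℚ (Set.range x))) /
      Module.finrank ℚ (IntermediateField.adjoin ℚ (Set.range x))

/-- Independence of the number field: height estimates over any field containing the coordinates
transfer to `tupleHeight`. -/
theorem tupleHeight_map {K : Type*} [Field K] [NumberField K] (f : K →+* Qbar)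
    {ι : Type*} [Finite ι] (x : ι → K) :
    tupleHeight (fun i => f (x i)) = logHeight x / Module.finrank ℚ K := by
  let f' : K →ₐ[ℚ] Qbar := f.toRatAlgHom
  have : NumberField (IntermediateField.adjoin ℚ (Set.range fun i => f (x i))) := {}
  have hle : IntermediateField.adjoin ℚ (Set.range fun i => f (x i)) ≤ f'.fieldRange := by
    rw [IntermediateField.adjoin_le_iff]
    rintro _ ⟨i, rfl⟩
    exact ⟨x i, rfl⟩
  let e : K ≃ₐ[ℚ] f'.fieldRange := AlgEquiv.ofInjectiveField f'
  let g : IntermediateField.adjoin ℚ (Set.range fun i => f (x i)) →+* K :=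
    (e.symm : f'.fieldRange →+* K).comp (IntermediateField.inclusion hle).toRingHom
  rw [tupleHeight, ← logHeight_map_div_finrank g]
  congr 2
  ext i
  change e.symm _ = _
  rw [AlgEquiv.symm_apply_eq]
  rfl

theorem exists_numberField_of_finite (S : Set Qbar) (hS : S.Finite) :
    ∃ (K : IntermediateField ℚ Qbar), NumberField K ∧ S ⊆ K := by
  have := hS.to_subtype
  have : FiniteDimensional ℚ (IntermediateField.adjoin ℚ S) :=
    IntermediateField.finiteDimensional_adjoin fun y _ => Algebra.IsIntegral.isIntegral y
  exact ⟨IntermediateField.adjoin ℚ S, {}, IntermediateField.subset_adjoin _ _⟩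

theorem exists_lift_of_finite {ι κ : Type*} [Finite ι] [Finite κ] (x : ι → Qbar) (y : κ → Qbar) :
    ∃ (K : IntermediateField ℚ Qbar), NumberField K ∧ ∃ (x' : ι → K) (y' : κ → K),
      x = (fun i => K.val (x' i)) ∧ y = fun i => K.val (y' i) := by
  obtain ⟨K, hK, h⟩ := exists_numberField_of_finite (Set.range x ∪ Set.range y)
    ((Set.finite_range x).union (Set.finite_range y))
  exact ⟨K, hK, fun i => ⟨x i, h (.inl ⟨i, rfl⟩)⟩, fun i => ⟨y i, h (.inr ⟨i, rfl⟩)⟩, rfl, rfl⟩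

section
variable {ι κ : Type*} [Finite ι] [Finite κ]

theorem tupleHeight_val {K : IntermediateField ℚ Qbar} [NumberField K] (x : ι → K) :
    tupleHeight (fun i => (x i : Qbar)) = logHeight x / Module.finrank ℚ K :=
  tupleHeight_map (K.val : K →+* Qbar) x

theorem tupleHeight_nonneg (x : ι → Qbar) : 0 ≤ tupleHeight x :=
  have : NumberField (IntermediateField.adjoin ℚ (Set.range x)) := {}
  div_nonneg (logHeight_nonneg _) (Nat.cast_nonneg _)

theorem tupleHeight_ringHom (σ : Qbar →+* Qbar) (x : ι → Qbar) :
    tupleHeight (fun i => σ (x i)) = tupleHeight x := by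
  obtain ⟨K, hK, x', y', rfl, -⟩ := exists_lift_of_finite x x
  refine Eq.trans ?_ (tupleHeight_map (K.val : K →+* Qbar) x').symm
  rw [← tupleHeight_map (σ.comp (K.val : K →+* Qbar)) x']
  rfl

theorem tupleHeight_smul (x : ι → Qbar) {c : Qbar} (hc : c ≠ 0) :
    tupleHeight (fun i => c * x i) = tupleHeight x := by
  obtain ⟨K, hK, x', y', rfl, h⟩ := exists_lift_of_finite x (fun _ : Unit => c)
  obtain rfl : c = _ := congrFun h ()
  have hc' : y' () ≠ 0 := fun h0 => hc (by simp [h0])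
  have := tupleHeight_val (y' () • x')
  rw [logHeight_smul_eq_logHeight _ hc', ← tupleHeight_val] at this
  simpa using this

theorem tupleHeight_comp_le (f : ι → κ) (x : κ → Qbar) :
    tupleHeight (fun i => x (f i)) ≤ tupleHeight x := by
  obtain ⟨K, hK, x', -, rfl, -⟩ := exists_lift_of_finite x x
  refine (tupleHeight_map (K.val : K →+* Qbar) fun i => x' (f i)).trans_le
    (le_of_le_of_eq ?_ (tupleHeight_map (K.val : K →+* Qbar) x').symm)
  gcongr
  exact logHeight_comp_le f x'

theorem tupleHeight_pow (x : ι → Qbar) (n : ℕ) :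
    tupleHeight (fun i => x i ^ n) = n * tupleHeight x := by
  obtain ⟨K, hK, x', -, rfl, -⟩ := exists_lift_of_finite x x
  have := tupleHeight_val (x' ^ n)
  rw [logHeight_pow, mul_div_assoc, ← tupleHeight_val] at this
  simpa using this

theorem tupleHeight_prod (N : ℕ) {x : ι → Qbar} (hx : x ≠ 0) :
    tupleHeight (fun I : Fin N → ι => ∏ a, x (I a)) = N * tupleHeight x := by
  obtain ⟨K, hK, x', -, rfl, -⟩ := exists_lift_of_finite x x
  have hx' : x' ≠ 0 := by rintro rfl; exact hx (by ext; simp)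
  have := tupleHeight_val (fun I : Fin N → ι => ∏ a, x' (I a))
  rw [logHeight_fun_prod_eq (x := fun _ : Fin N => x') fun _ => hx', Finset.sum_const,
    Finset.card_univ, Fintype.card_fin, nsmul_eq_mul, mul_div_assoc, ← tupleHeight_val] at this
  simpa using this

theorem tupleHeight_linearMap_le {ι : Type*} [Fintype ι] (A : κ × ι → Qbar) (x : ι → Qbar) :
    tupleHeight (fun j => ∑ i, A (j, i) * x i) ≤
      Real.log (Nat.card ι) + tupleHeight A + tupleHeight x := by
  obtain ⟨K, hK, x', A', rfl, rfl⟩ := exists_lift_of_finite x A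
  have h := logHeight_linearMap_apply_le A' x'
  have hK : (0 : ℝ) < Module.finrank ℚ K := by exact_mod_cast Module.finrank_pos
  have := tupleHeight_val (fun j => ∑ i, A' (j, i) * x' i)
  rw [totalWeight_eq_finrank] at h
  have h2 := div_le_div_of_nonneg_right h hK.le
  rw [← this, add_div, add_div, mul_div_cancel_left₀ _ hK.ne', ← tupleHeight_val,
    ← tupleHeight_val] at h2
  simpa using h2

theorem absLogHeight₁_eq_tupleHeight (x : Qbar) : absLogHeight₁ x = tupleHeight ![x, 1] := by
  have hx : IsIntegral ℚ x := Algebra.IsIntegral.isIntegral x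
  have : FiniteDimensional ℚ (IntermediateField.adjoin ℚ {x}) :=
    IntermediateField.adjoin.finiteDimensional hx
  have : NumberField (IntermediateField.adjoin ℚ {x}) := {}
  have h := tupleHeight_val ![IntermediateField.AdjoinSimple.gen ℚ x, 1]
  rw [← logHeight₁_eq_logHeight] at h
  have h2 : (fun i => ((![IntermediateField.AdjoinSimple.gen ℚ x, 1] i : 
      IntermediateField.adjoin ℚ {x}) : Qbar)) = ![x, 1] := by
    ext i; fin_cases i <;> simp
  rw [← h2, h, absLogHeight₁, absMulHeight₁, dif_pos hx, Real.log_rpow (mulHeight₁_pos _),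
    logHeight₁, div_eq_inv_mul]

theorem absLogHeight₁_nonneg (x : Qbar) : 0 ≤ absLogHeight₁ x :=
  absLogHeight₁_eq_tupleHeight x ▸ tupleHeight_nonneg _

theorem absLogHeight₁_ringHom (σ : Qbar →+* Qbar) (x : Qbar) :
    absLogHeight₁ (σ x) = absLogHeight₁ x := by
  rw [absLogHeight₁_eq_tupleHeight, absLogHeight₁_eq_tupleHeight, ← tupleHeight_ringHom σ ![x, 1]]
  congr 1
  ext i; fin_cases i <;> simp

theorem absLogHeight₁_eq_logHeight₁ {K : IntermediateField ℚ Qbar} [NumberField K] (x : K) :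
    absLogHeight₁ (x : Qbar) = logHeight₁ x / Module.finrank ℚ K := by
  rw [absLogHeight₁_eq_tupleHeight, logHeight₁_eq_logHeight, ← tupleHeight_val]
  congr 1
  ext i; fin_cases i <;> simp

theorem absLogHeight₁_mul_sub_le (x y z : Qbar) :
    absLogHeight₁ (x - y * z) ≤
      Real.log 2 + absLogHeight₁ x + absLogHeight₁ y + absLogHeight₁ z := by
  obtain ⟨K, hK, h⟩ := exists_numberField_of_finite {x, y, z} (Set.toFinite _)
  lift x to K using h (by simp)
  lift y to K using h (by simp)
  lift z to K using h (by simp)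
  have hK : (0 : ℝ) < Module.finrank ℚ K := by exact_mod_cast Module.finrank_pos
  have h1 := logHeight₁_sub_le x (y * z)
  have h2 := logHeight₁_mul_le y z
  have h3 := absLogHeight₁_eq_logHeight₁ (x - y * z)
  push_cast at h3
  rw [h3, absLogHeight₁_eq_logHeight₁, absLogHeight₁_eq_logHeight₁, absLogHeight₁_eq_logHeight₁,
    div_le_iff₀ hK]
  rw [totalWeight_eq_finrank] at h1
  field_simp
  linarith

end

/-! ### Upper and lower height bounds for polynomial and rational maps. -/

open MvPolynomial in
-- The values are a fixed coefficient matrix applied to monomials of degree `N`. These form a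
-- subfamily of all `N`-fold products of coordinates, whose height is exactly `N` times that of the
-- point.
theorem exists_tupleHeight_eval_le {ι κ : Type*} [Finite ι] [Finite κ] {N : ℕ}
    {p : κ → MvPolynomial ι Qbar} (hp : ∀ j, (p j).IsHomogeneous N) :
    ∃ C : ℝ, ∀ x : ι → Qbar, x ≠ 0 →
      tupleHeight (fun j => eval x (p j)) ≤ C + N * tupleHeight x := by
  classical
  have := Fintype.ofFinite ι
  have := Fintype.ofFinite κ
  let S : Finset (ι →₀ ℕ) := Finset.univ.biUnion fun j => (p j).support
  -- A monomial of degree `N` is written as a word of `N` variables.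
  have hS (s : S) : ∃ I : Fin N → ι, ∀ x : ι → Qbar, ∏ a, x (I a) = ∏ i, x i ^ s.1 i := by
    obtain ⟨s, hs⟩ := s
    simp only [S, Finset.mem_biUnion, Finset.mem_univ, true_and] at hs
    obtain ⟨j, hj⟩ := hs
    have hdeg : N = (Finsupp.toMultiset s).toList.length := by
      rw [Multiset.length_toList, Finsupp.card_toMultiset, (hp j).degree_eq_sum_deg_support hj]
      rfl
    refine ⟨fun a => (Finsupp.toMultiset s).toList.get (a.cast hdeg), fun x => ?_⟩
    rw [← Fintype.prod_equiv (finCongr hdeg.symm)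
      (fun a => x ((Finsupp.toMultiset s).toList.get a)) _ (fun _ => rfl)]
    have h := Finsupp.prod_toMultiset (s.mapDomain x)
    rw [← Finsupp.toMultiset_map, ← Multiset.coe_toList (Finsupp.toMultiset s), Multiset.map_coe,
      Multiset.prod_coe, Finsupp.prod_mapDomain_index (by simp) (by intros; exact pow_add _ _ _),
      Finsupp.prod_fintype _ _ (by simp)] at h
    rw [← h, ← List.prod_ofFn]
    congr 1
    conv_rhs => rw [← List.ofFn_get (Finsupp.toMultiset s).toList]
    rw [List.map_ofFn]
    rfl
  choose I hI using hS
  refine ⟨Real.log (Nat.card S) + tupleHeight (fun a : κ × S => coeff a.2.1 (p a.1)), fun x hx => ?_⟩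
  have h1 := tupleHeight_linearMap_le (fun a : κ × S => coeff a.2.1 (p a.1))
    fun s : S => ∏ a, x (I s a)
  have h2 := tupleHeight_comp_le I fun I : Fin N → ι => ∏ a, x (I a)
  rw [tupleHeight_prod N hx] at h2
  have h3 : (fun j => eval x (p j)) = fun j => ∑ s : S, coeff s.1 (p j) * ∏ a, x (I s a) := by
    ext j
    simp only [hI]
    rw [eval_eq', Finset.sum_coe_sort S fun s => coeff s (p j) * ∏ i, x i ^ s i]
    refine Finset.sum_subset (fun s hs => Finset.mem_biUnion.2 ⟨j, Finset.mem_univ _, hs⟩) ?_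
    intro s _ hs
    rw [notMem_support_iff.1 hs, zero_mul]
  rw [h3]
  linarith

open MvPolynomial in
-- By the Nullstellensatz a power of each variable lies in the ideal of the `G j`; taking components
-- of degree `e` makes the cofactors homogeneous.
theorem exists_sum_mul_eq_X_pow {k : Type*} [Field k] [IsAlgClosed k] {ι κ : Type*} [Finite ι] [Fintype κ]
    {G : κ → MvPolynomial ι k} {d : κ → ℕ} (hG : ∀ j, (G j).IsHomogeneous (d j))
    (h0 : ∀ y : ι → k, (∀ j, eval y (G j) = 0) → y = 0) :
    ∃ e : ℕ, (∀ j, d j ≤ e) ∧ ∃ q : ι × κ → MvPolynomial ι k,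
      (∀ i j, (q (i, j)).IsHomogeneous (e - d j)) ∧ ∀ i, ∑ j, q (i, j) * G j = X i ^ e := by
  classical
  have := Fintype.ofFinite ι
  have hrad (i : ι) : (X i : MvPolynomial ι k) ∈ (Ideal.span (Set.range G)).radical := by
    rw [← vanishingIdeal_zeroLocus_eq_radical (K := k)]
    intro y hy
    have : y = 0 := h0 y fun j => by
      simpa using hy (G j) (Ideal.subset_span ⟨j, rfl⟩)
    simp [this]
  choose r hr using hrad
  let e := ∑ i, r i + ∑ j, d j
  have hd (j : κ) : d j ≤ e := by
    have := Finset.single_le_sum (f := d) (fun _ _ => Nat.zero_le _) (Finset.mem_univ j)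
    omega
  have hre (i : ι) : ∃ c : κ → MvPolynomial ι k, ∑ j, c j * G j = X i ^ e := by
    rw [← Ideal.mem_span_range_iff_exists_fun]
    refine Ideal.pow_mem_of_pow_mem _ (hr i) ?_
    have := Finset.single_le_sum (f := r) (fun _ _ => Nat.zero_le _) (Finset.mem_univ i)
    omega
  choose c hc using hre
  refine ⟨e, hd, fun a => homogeneousComponent (e - d a.2) (c a.1 a.2),
    fun i j => homogeneousComponent_isHomogeneous _ _, fun i => ?_⟩
  have h := congrArg (homogeneousComponent e) (hc i)
  rw [map_sum, homogeneousComponent_of_mem (isHomogeneous_X_pow i e), if_pos rfl] at h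
  rw [← h]
  refine Finset.sum_congr rfl fun j _ => ?_
  let := gradedAlgebra (σ := ι) (R := k)
  have := DirectSum.coe_decompose_mul_of_right_mem_of_le (homogeneousSubmodule ι k) (a := c i j)
    (n := e) (hG j) (hd j)
  exact ((congrArg (· * G j) (decomposition.decompose'_apply (c i j) (e - d j))).symm.trans
    this.symm).trans (decomposition.decompose'_apply (c i j * G j) e)

open MvPolynomial in
-- The Nullstellensatz identities express the `x i ^ e` linearly in the `G j`. Padding the cofactors
-- by powers of `X i₀`, which equals `1` at `x`, brings them all to degree `e - m`, so $e\,h(x)\le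
-- C+(e-m)h(x)+h(G(x))$.
theorem exists_mul_tupleHeight_le {ι κ : Type*} [Finite ι] [Finite κ]
    {G : κ → MvPolynomial ι Qbar} {d : κ → ℕ} (hG : ∀ j, (G j).IsHomogeneous (d j))
    (h0 : ∀ y : ι → Qbar, (∀ j, eval y (G j) = 0) → y = 0) {m : ℕ} (hm : ∀ j, m ≤ d j) (i₀ : ι) :
    ∃ C : ℝ, ∀ x : ι → Qbar, x i₀ = 1 →
      m * tupleHeight x ≤ C + tupleHeight (fun j => eval x (G j)) := by
  have := Fintype.ofFinite κ
  obtain ⟨e, hde, q, hq, hqe⟩ := exists_sum_mul_eq_X_pow hG h0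
  have hq' (a : ι × κ) : (q a * X i₀ ^ (d a.2 - m)).IsHomogeneous (e - m) := by
    have := (hq a.1 a.2).mul (isHomogeneous_X_pow (R := Qbar) i₀ (d a.2 - m))
    have h1 := hde a.2
    have h2 := hm a.2
    rwa [show e - d a.2 + (d a.2 - m) = e - m by omega] at this
  obtain ⟨C, hC⟩ := exists_tupleHeight_eval_le hq'
  refine ⟨Real.log (Nat.card κ) + C, fun x hx => ?_⟩
  have hx0 : x ≠ 0 := fun h => by simp [h] at hx
  have h1 := tupleHeight_linearMap_le (fun a => eval x (q a * X i₀ ^ (d a.2 - m)))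
    fun j => eval x (G j)
  have h2 : (fun i => ∑ j, eval x (q (i, j) * X i₀ ^ (d j - m)) * eval x (G j)) =
      fun i => x i ^ e := by
    ext i
    simpa [hx] using congrArg (eval x) (hqe i)
  rw [h2, tupleHeight_pow] at h1
  have h3 := hC x hx0
  rcases isEmpty_or_nonempty κ with hκ | ⟨⟨j⟩⟩
  · have := h0 x (fun j => (hκ.false j).elim)
    exact absurd this hx0
  rw [Nat.cast_sub ((hm j).trans (hde j))] at h3
  linarith

/-- Homogenization of degree `d` with respect to an additional variable `none`; it is the usual one
if `p` has degree at most `d`. -/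
noncomputable def MvPolynomial.homogenizeNone {k ι : Type*} [Field k] (d : ℕ)
    (p : MvPolynomial ι k) : MvPolynomial (Option ι) k :=
  ∑ i ∈ Finset.range (d + 1),
    MvPolynomial.rename some (MvPolynomial.homogeneousComponent i p) *
      MvPolynomial.X none ^ (d - i)

namespace MvPolynomial
variable {k ι : Type*} [Field k]

theorem isHomogeneous_homogenizeNone (d : ℕ) (p : MvPolynomial ι k) :
    (p.homogenizeNone d).IsHomogeneous d := by
  refine IsHomogeneous.sum _ _ _ fun i hi => ?_
  have h := ((homogeneousComponent_isHomogeneous i p).rename_isHomogeneous (f := some)).mul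
    (isHomogeneous_X_pow (R := k) (none : Option ι) (d - i))
  rwa [show i + (d - i) = d by have := Finset.mem_range.1 hi; omega] at h

theorem eval_homogenizeNone_of_one {d : ℕ} {p : MvPolynomial ι k} (hp : p.totalDegree ≤ d)
    {y : Option ι → k} (hy : y none = 1) :
    eval y (p.homogenizeNone d) = eval (fun i => y (some i)) p := by
  have h : ∑ i ∈ Finset.range (d + 1), homogeneousComponent i p = p := by
    conv_rhs => rw [← sum_homogeneousComponent p]
    refine (Finset.sum_subset (fun i hi => ?_) fun i _ hi => ?_).symm
    · rw [Finset.mem_range] at hi ⊢; omega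
    · exact homogeneousComponent_eq_zero _ _ (by rw [Finset.mem_range] at hi; omega)
  conv_rhs => rw [← h]
  simp [homogenizeNone, hy, eval_rename, Function.comp_def]

theorem eval_homogenizeNone_of_zero (d : ℕ) (p : MvPolynomial ι k)
    {y : Option ι → k} (hy : y none = 0) :
    eval y (p.homogenizeNone d) = eval (fun i => y (some i)) (homogeneousComponent d p) := by
  rw [homogenizeNone, Finset.sum_range_succ, map_add, map_sum, Finset.sum_eq_zero, zero_add]
  · simp [eval_rename, Function.comp_def]
  · intro i hi
    have : d - i ≠ 0 := by have := Finset.mem_range.1 hi; omega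
    simp [hy, this]

end MvPolynomial

/-- The absolute logarithmic height of a point of affine space. -/
noncomputable def affineHeight {ι : Type*} [Finite ι] (x : ι → Qbar) : ℝ :=
  tupleHeight fun i : Option ι => i.elim 1 x

theorem affineHeight_nonneg {ι : Type*} [Finite ι] (x : ι → Qbar) : 0 ≤ affineHeight x :=
  tupleHeight_nonneg _

theorem absLogHeight₁_le_affineHeight {ι : Type*} [Finite ι] (x : ι → Qbar) (i : ι) :
    absLogHeight₁ (x i) ≤ affineHeight x := by
  rw [absLogHeight₁_eq_tupleHeight]
  convert! tupleHeight_comp_le ![some i, none] (fun i : Option ι => i.elim 1 x) using 2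
  ext j; fin_cases j <;> rfl

open MvPolynomial in
theorem exists_affineHeight_eval_le {ι κ : Type*} [Finite ι] [Finite κ] {M : ℕ}
    {p : κ → MvPolynomial ι Qbar} (hp : ∀ j, (p j).totalDegree ≤ M) :
    ∃ C : ℝ, ∀ x : ι → Qbar,
      affineHeight (fun j => eval x (p j)) ≤ C + M * affineHeight x := by
  obtain ⟨C, hC⟩ := exists_tupleHeight_eval_le
    (p := fun j : Option κ => j.elim (X none ^ M) fun j => (p j).homogenizeNone M)
    (by rintro (_ | j); exacts [isHomogeneous_X_pow _ _, isHomogeneous_homogenizeNone _ _])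
  refine ⟨C, fun x => ?_⟩
  refine Eq.trans_le ?_ (hC (fun i : Option ι => i.elim 1 x)
    (fun h => one_ne_zero (congrFun h none)))
  refine congrArg tupleHeight ?_
  ext (_ | j)
  · simp
  · exact (eval_homogenizeNone_of_one (y := fun i => i.elim 1 x) (hp j) rfl).symm

open MvPolynomial in
theorem exists_mul_affineHeight_le {ι κ : Type*} [Finite ι] [Finite κ] {m : ℕ} (hm0 : m ≠ 0)
    {f : κ → MvPolynomial ι Qbar} (hm : ∀ j, m ≤ (f j).totalDegree)
    (h0 : ∀ y : ι → Qbar, (∀ j, eval y (homogeneousComponent (f j).totalDegree (f j)) = 0) →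
      y = 0) :
    ∃ C : ℝ, ∀ x : ι → Qbar,
      m * affineHeight x ≤ C + affineHeight (fun j => eval x (f j)) := by
  rcases isEmpty_or_nonempty ι with hι | hι
  · refine ⟨0, fun x => ?_⟩
    have h : affineHeight x = 0 := by
      have := tupleHeight_pow (fun i : Option ι => i.elim 1 x) 2
      have h2 : (fun i : Option ι => (i.elim 1 x : Qbar) ^ 2) = fun i : Option ι => i.elim 1 x := by
        ext (_ | i)
        · simp
        · exact hι.elim i
      rw [h2] at this
      rw [affineHeight]
      push_cast at this
      linarith
    rw [h]
    linarith [affineHeight_nonneg fun j => eval x (f j)]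
  obtain ⟨C, hC⟩ := exists_mul_tupleHeight_le (m := m) (i₀ := (none : Option ι))
    -- The extra form `X none ^ m` forces a common zero onto the hyperplane at infinity, where only
    -- the leading forms remain.
    (G := fun j : Option κ => j.elim (X none ^ m) fun j => (f j).homogenizeNone (f j).totalDegree)
    (d := fun j => j.elim m fun j => (f j).totalDegree)
    (by rintro (_ | j); exacts [isHomogeneous_X_pow _ _, isHomogeneous_homogenizeNone _ _])
    (by
      intro y hy
      have hn : y none = 0 := by simpa [hm0] using hy none
      have hs := h0 (fun i => y (some i)) fun j => by
        rw [← eval_homogenizeNone_of_zero _ _ hn]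
        exact hy (some j)
      ext (_ | i)
      exacts [hn, congrFun hs i])
    (by rintro (_ | j); exacts [le_rfl, hm j])
  refine ⟨C, fun x => ?_⟩
  refine (hC (fun i : Option ι => i.elim 1 x) rfl).trans_eq ?_
  refine congrArg (fun z => C + tupleHeight z) ?_
  ext (_ | j)
  · simp
  · exact eval_homogenizeNone_of_one (p := f j) (y := fun i => i.elim 1 x) le_rfl rfl

theorem Polynomial.eval_homogenize_of_eq_zero {k : Type*} [Field k] (p : Polynomial k) (n : ℕ)
    (x : Fin 2 → k) (hx : x 1 = 0) :
    MvPolynomial.eval x (p.homogenize n) = p.coeff n * x 0 ^ n := by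
  rw [homogenize, map_sum, Finset.Nat.sum_antidiagonal_eq_sum_range_succ_mk,
    Finset.sum_range_succ, Finset.sum_eq_zero, zero_add]
  · simp [MvPolynomial.eval_monomial, Finsupp.prod_fintype, hx]
  · intro i hi
    have : n - i ≠ 0 := by have := Finset.mem_range.1 hi; omega
    simp [MvPolynomial.eval_monomial, Finsupp.prod_fintype, hx, this]

theorem exists_mul_absLogHeight₁_le {P Q : Polynomial Qbar} (hPQ : IsCoprime P Q) :
    ∃ C : ℝ, ∀ x : Qbar, Q.eval x ≠ 0 →
      (max P.natDegree Q.natDegree : ℕ) * absLogHeight₁ x ≤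
        C + absLogHeight₁ (P.eval x / Q.eval x) := by
  set d := max P.natDegree Q.natDegree with hd
  have hP : P.natDegree ≤ d := le_max_left _ _
  have hQ : Q.natDegree ≤ d := le_max_right _ _
  obtain ⟨C, hC⟩ := exists_mul_tupleHeight_le (m := d) (i₀ := (1 : Fin 2))
    (G := ![P.homogenize d, Q.homogenize d]) (d := fun _ => d)
    (by intro j; fin_cases j <;> exact Polynomial.isHomogeneous_homogenize _)
    (by
      intro y hy
      have h1 : MvPolynomial.eval y (P.homogenize d) = 0 := hy 0
      have h2 : MvPolynomial.eval y (Q.homogenize d) = 0 := hy 1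
      by_cases hy1 : y 1 = 0
      · rw [Polynomial.eval_homogenize_of_eq_zero _ _ _ hy1, mul_eq_zero] at h1 h2
        -- At infinity only the coefficients of degree `d` matter; they cannot both vanish, since
        -- `d` is the larger degree and the polynomials are coprime.
        have h3 : y 0 ^ d = 0 := by
          by_contra h4
          have hP0 := h1.resolve_right h4
          have hQ0 := h2.resolve_right h4
          have hPd : P = 0 ∨ P.natDegree < d := by
            rcases hP.lt_or_eq with h | h
            · exact .inr h
            · rw [← h, Polynomial.coeff_natDegree, Polynomial.leadingCoeff_eq_zero] at hP0
              exact .inl hP0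
          have hQd : Q = 0 ∨ Q.natDegree < d := by
            rcases hQ.lt_or_eq with h | h
            · exact .inr h
            · rw [← h, Polynomial.coeff_natDegree, Polynomial.leadingCoeff_eq_zero] at hQ0
              exact .inl hQ0
          rcases hPd with rfl | hPd
          · rcases hQd with rfl | hQd
            · exact not_isCoprime_zero_zero hPQ
            · simp at hd; omega
          · rcases hQd with rfl | hQd
            · simp at hd; omega
            · omega
        ext j
        fin_cases j
        exacts [eq_zero_of_pow_eq_zero h3, hy1]
      · rw [Polynomial.eval_homogenize hP _ hy1, mul_eq_zero, or_iff_left (pow_ne_zero _ hy1)] at h1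
        rw [Polynomial.eval_homogenize hQ _ hy1, mul_eq_zero, or_iff_left (pow_ne_zero _ hy1)] at h2
        obtain ⟨a, b, hab⟩ := hPQ
        have h3 := congrArg (Polynomial.eval (y 0 / y 1)) hab
        simp [h1, h2] at h3)
    (fun _ => le_rfl)
  refine ⟨C, fun x hx => ?_⟩
  have h := hC ![x, 1] rfl
  rw [← absLogHeight₁_eq_tupleHeight] at h
  refine h.trans_eq ?_
  rw [absLogHeight₁_eq_tupleHeight, ← tupleHeight_smul ![_, 1] hx]
  congr 2
  ext j
  fin_cases j
  · simp [Polynomial.eval_homogenize hP, mul_div_cancel₀, hx]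
  · simp [Polynomial.eval_homogenize hQ]

/-! ### From property (N) to (K), (SP), (P), ($\overline{\mathrm P}$) and (R). -/

/-- Some sublevel set `F` is finite, stable under `g` and eventually entered by every orbit. Being
injective, `g` permutes `F`, so a point outside `F` can never enter it; hence `X` is contained in
`F`. -/
theorem finite_of_contracting {S : Type*} (h : S → ℝ) (X : Set S)
    (hfin : ∀ B : ℝ, {x ∈ X | h x ≤ B}.Finite) (g : S → S) (hg : Set.MapsTo g X X)
    (hinj : Set.InjOn g X) {c C : ℝ} (hc0 : 0 ≤ c) (hc : c < 1)
    (hh : ∀ x ∈ X, h (g x) ≤ c * h x + C) : X.Finite := by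
  -- The fixed point of $t\mapsto ct+C$, towards which heights are driven.
  set B₀ := C / (1 - c)
  have hB₀ : C = (1 - c) * B₀ := by rw [mul_div_cancel₀]; linarith
  set F := {x ∈ X | h x ≤ B₀ + 1}
  have hFg : Set.MapsTo g F F := fun x hx => ⟨hg hx.1, by
    have h1 := hh x hx.1
    have h2 := mul_le_mul_of_nonneg_left hx.2 hc0
    linarith⟩
  have hsurj : Set.SurjOn g F F :=
    (Set.eq_of_subset_of_ncard_le hFg.image_subset
      (hinj.mono fun x hx => hx.1).ncard_image.ge (hfin _)).ge
  have hback : ∀ x ∈ X, g x ∈ F → x ∈ F := by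
    intro x hx hgx
    obtain ⟨y, hy, hyx⟩ := hsurj hgx
    rwa [← hinj hy.1 hx hyx]
  have hiter : ∀ n : ℕ, ∀ x ∈ X, g^[n] x ∈ F → x ∈ F := by
    intro n
    induction n with
    | zero => exact fun x _ h => h
    | succ n ih => exact fun x hx hn => hback x hx (ih (g x) (hg hx) hn)
  have hbd : ∀ n : ℕ, ∀ x ∈ X, h (g^[n] x) - B₀ ≤ c ^ n * |h x - B₀| := by
    intro n
    induction n with
    | zero =>
      intro x _
      rw [pow_zero, one_mul]
      exact le_abs_self _
    | succ n ih =>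
      intro x hx
      rw [Function.iterate_succ_apply']
      have h1 := hh _ (hg.iterate n hx)
      have h2 := mul_le_mul_of_nonneg_left (ih x hx) hc0
      rw [pow_succ]
      linarith
  refine (hfin (B₀ + 1)).subset fun x hx => ?_
  have hlim : Filter.Tendsto (fun n : ℕ => c ^ n * |h x - B₀|) Filter.atTop (nhds 0) := by
    simpa using (tendsto_pow_atTop_nhds_zero_of_lt_one hc0 hc).mul_const |h x - B₀|
  obtain ⟨n, hn⟩ := (hlim.eventually (gt_mem_nhds one_pos)).exists
  exact hiter n x hx ⟨hg.iterate n hx, by linarith [hbd n x hx]⟩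

theorem PropertyN.finite_le {K : IntermediateField ℚ Qbar} (hK : PropertyN (K : Set Qbar)) (B : ℝ) :
    {a : K | absLogHeight₁ (a : Qbar) ≤ B}.Finite := by
  refine ((hK (max B 0 + 1) (by positivity)).preimage (f := ((↑) : K → Qbar))
    Subtype.val_injective.injOn).subset fun a ha => ⟨a.2, ?_⟩
  have : absLogHeight₁ (a : Qbar) ≤ B := ha
  linarith [le_max_left B 0]

theorem PropertyN.finite_affineHeight_le {K : IntermediateField ℚ Qbar}
    (hK : PropertyN (K : Set Qbar)) {ι : Type*} [Finite ι] (B : ℝ) :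
    {x : ι → K | affineHeight (fun i => (x i : Qbar)) ≤ B}.Finite :=
  (Set.Finite.pi' fun _ => hK.finite_le B).subset fun x hx i =>
    (absLogHeight₁_le_affineHeight (fun i => (x i : Qbar)) i).trans hx

theorem MvPolynomial.map_homogeneousComponent {R S σ : Type*} [CommSemiring R] [CommSemiring S]
    (f : R →+* S) (n : ℕ) (p : MvPolynomial σ R) :
    map f (homogeneousComponent n p) = homogeneousComponent n (map f p) := by
  ext d
  simp only [coeff_map, coeff_homogeneousComponent]
  split_ifs <;> simp

theorem nonempty_algEquiv_algebraicClosure (k E : Type*) [Field k] [Field E] [Algebra k E]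
    [IsAlgClosure k E] : Nonempty (AlgebraicClosure k ≃ₐ[k] E) :=
  ⟨IsAlgClosure.equiv k _ _⟩

instance isAlgClosure_Qbar (K : IntermediateField ℚ Qbar) : IsAlgClosure K Qbar :=
  ⟨inferInstance, Algebra.IsAlgebraic.tower_top (K := ℚ) K⟩

theorem IsAdmissible.eq_zero {K : IntermediateField ℚ Qbar} {n : ℕ}
    {f : Fin n → MvPolynomial (Fin n) K} (hf : IsAdmissible f) {y : Fin n → Qbar}
    (hy : ∀ i, MvPolynomial.aeval y (leadingForm (f i)) = 0) : y = 0 := by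
  obtain ⟨e'⟩ := nonempty_algEquiv_algebraicClosure K Qbar
  let e := e'.symm
  have h := hf.2 (fun i => e (y i)) fun i => by
    have h1 := MvPolynomial.comp_aeval_apply y (e : Qbar →ₐ[K] AlgebraicClosure K)
      (leadingForm (f i))
    rw [hy i, map_zero] at h1
    exact h1.symm
  funext i
  exact e.map_eq_zero_iff.1 (congrFun h i)

theorem polyMap_coe {K : IntermediateField ℚ Qbar} {n : ℕ} (f : Fin n → MvPolynomial (Fin n) K)
    (x : Fin n → K) : (fun i => ((polyMap f x i : K) : Qbar)) =
      fun i => MvPolynomial.eval (fun i => (x i : Qbar))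
        (MvPolynomial.map (algebraMap K Qbar) (f i)) := by
  ext i
  exact MvPolynomial.map_eval (algebraMap K Qbar) x (f i)

theorem PropertyN.propertyK {K : IntermediateField ℚ Qbar} (hK : PropertyN (K : Set Qbar)) :
    PropertyK K := by
  intro n hn Φ Ψ hΦ hdeg X hX hinj
  have hinjK := FaithfulSMul.algebraMap_injective K Qbar
  have htd (p : MvPolynomial (Fin n) K) :
      (MvPolynomial.map (algebraMap K Qbar) p).totalDegree = p.totalDegree :=
    by
    rw [MvPolynomial.totalDegree, MvPolynomial.support_map_of_injective _ hinjK]; rfl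
  set M := Finset.univ.sup fun j => (Ψ j).totalDegree
  have hMm (i : Fin n) : M + 1 ≤ (Φ i).totalDegree :=
    (Finset.sup_lt_iff (by rw [Nat.bot_eq_zero]; have := hΦ.1 i; omega)).2 fun j _ => hdeg i j
  obtain ⟨C₁, hC₁⟩ := exists_affineHeight_eval_le (M := M)
    (p := fun j => MvPolynomial.map (algebraMap K Qbar) (Ψ j)) fun j => by
      rw [htd]; exact Finset.le_sup (f := fun j => (Ψ j).totalDegree) (Finset.mem_univ j)
  obtain ⟨C₂, hC₂⟩ := exists_mul_affineHeight_le (m := M + 1) (by omega)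
    (f := fun j => MvPolynomial.map (algebraMap K Qbar) (Φ j)) (fun j => by rw [htd]; exact hMm j)
    fun y hy => hΦ.eq_zero fun i => by
      have := hy i
      rwa [htd, ← MvPolynomial.map_homogeneousComponent, MvPolynomial.eval_map,
        ← MvPolynomial.aeval_def] at this
  -- The contracting map picks a $\Phi$-preimage of $\Psi(x)$ in `X`; it is injective because $\Psi$
  -- is injective on `X`.
  have hg : ∀ x ∈ X, ∃ y ∈ X, polyMap Φ y = polyMap Ψ x := fun x hx => hX ⟨x, hx, rfl⟩
  choose! g hgX hg using hg
  refine finite_of_contracting (fun x : Fin n → K => affineHeight fun i => (x i : Qbar)) X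
    (fun B => (hK.finite_affineHeight_le (ι := Fin n) B).inter_of_right X) g hgX
    (fun x hx y hy hxy => hinj hx hy (by rw [← hg x hx, ← hg y hy, hxy]))
    (c := M / (M + 1)) (C := (C₁ + C₂) / (M + 1)) (by positivity)
    ((div_lt_one (by positivity)).2 (by linarith)) fun x hx => ?_
  have h1 := hC₁ fun i => (x i : Qbar)
  have h2 := hC₂ fun i => (g x i : Qbar)
  rw [← polyMap_coe] at h1 h2
  rw [hg x hx] at h2
  push_cast at h2
  rw [div_mul_eq_mul_div, ← add_div, le_div_iff₀ (by positivity)]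
  linarith

theorem PropertyK.propertySP {K : Type*} [Field K] (hK : PropertyK K) : PropertySP K := by
  intro n hn f hf X hX
  have hid : polyMap (fun i : Fin n => (MvPolynomial.X i : MvPolynomial (Fin n) K)) = id := by
    ext x i; simp [polyMap]
  refine hK n hn f (fun i => MvPolynomial.X i) hf (fun i j => ?_) X ?_ ?_
  · rw [MvPolynomial.totalDegree_X]
    exact hf.1 i
  · rw [hid, Set.image_id, hX]
  · rw [hid]
    exact Function.injective_id.injOn

theorem PropertySP.propertyP {K : Type*} [Field K] (hK : PropertySP K) : PropertyP K :=
  hK 1 le_rfl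

theorem absLogHeight₁_zero : absLogHeight₁ (0 : Qbar) = 0 := by
  obtain ⟨K, hK, -⟩ := exists_numberField_of_finite ∅ Set.finite_empty
  simpa using absLogHeight₁_eq_logHeight₁ (0 : K)

theorem absLogHeight₁_one : absLogHeight₁ (1 : Qbar) = 0 := by
  obtain ⟨K, hK, -⟩ := exists_numberField_of_finite ∅ Set.finite_empty
  simpa using absLogHeight₁_eq_logHeight₁ (1 : K)

open Polynomial in
-- Each new linear factor turns a bound $b$ into $2b+\log 2+B$, which accounts for the constant.
theorem absLogHeight₁_coeff_prod_le {B : ℝ} (s : Multiset Qbar)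
    (hs : ∀ a ∈ s, absLogHeight₁ a ≤ B) (j : ℕ) :
    absLogHeight₁ ((s.map fun a => X - C a).prod.coeff j) ≤
      (2 ^ Multiset.card s - 1) * (Real.log 2 + B) := by
  induction s using Multiset.induction generalizing j with
  | empty =>
    rw [Multiset.map_zero, Multiset.prod_zero, coeff_one]
    split_ifs <;> simp [absLogHeight₁_zero, absLogHeight₁_one]
  | cons a s ih =>
    have ih' := ih fun a ha => hs a (Multiset.mem_cons_of_mem ha)
    set q := (s.map fun a => X - C a).prod
    have h0 : (0 : ℝ) ≤ (2 ^ Multiset.card s - 1) * (Real.log 2 + B) :=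
      (absLogHeight₁_nonneg _).trans (ih' 0)
    have h1 : ∃ b, absLogHeight₁ b ≤ (2 ^ Multiset.card s - 1) * (Real.log 2 + B) ∧
        ((X - C a) * q).coeff j = b - a * q.coeff j := by
      rw [sub_mul (X : Qbar[X]), coeff_sub, coeff_C_mul]
      cases j with
      | zero => exact ⟨0, by rwa [absLogHeight₁_zero], by simp⟩
      | succ j => exact ⟨_, ih' j, by rw [coeff_X_mul]⟩
    obtain ⟨b, hb, h1⟩ := h1
    rw [Multiset.map_cons, Multiset.prod_cons, Multiset.card_cons, h1]
    have h2 := absLogHeight₁_mul_sub_le b a (q.coeff j)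
    have h3 := ih' j
    have h4 := hs a (Multiset.mem_cons_self _ _)
    rw [pow_succ]
    linarith

theorem Polynomial.finite_of_coeff_mem {R : Type*} [Semiring R] {A : Set R} (hA : A.Finite) (D : ℕ) :
    {p : Polynomial R | p.natDegree ≤ D ∧ ∀ i, p.coeff i ∈ A}.Finite := by
  refine Set.Finite.of_finite_image (f := fun p => fun i : Fin (D + 1) => p.coeff i)
    ((Set.Finite.pi' fun _ => hA).subset ?_) ?_
  · rintro _ ⟨p, hp, rfl⟩ i
    exact hp.2 i
  · intro p hp q hq hpq
    ext i
    by_cases hi : i < D + 1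
    · exact congrFun hpq ⟨i, hi⟩
    · rw [coeff_eq_zero_of_natDegree_lt (by have := hp.1; omega),
        coeff_eq_zero_of_natDegree_lt (by have := hq.1; omega)]

/-- Conjugates over `K` share the same height, so the coefficients of the minimal polynomial have
bounded height in `K`; only finitely many such polynomials exist. -/
theorem PropertyN.finite_of_natDegree_minpoly_le {K : IntermediateField ℚ Qbar}
    (hK : PropertyN (K : Set Qbar)) (D : ℕ) (B : ℝ) :
    {z : Qbar | (minpoly K z).natDegree ≤ D ∧ absLogHeight₁ z ≤ B}.Finite := by
  rcases lt_or_ge B 0 with hB | hB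
  · refine Set.finite_empty.subset fun z hz => ?_
    linarith [hz.2, absLogHeight₁_nonneg z]
  have hfin := Polynomial.finite_of_coeff_mem
    (hK.finite_le ((2 ^ D - 1) * (Real.log 2 + B))) D
  have : Normal K Qbar := IsAlgClosure.normal K Qbar
  refine (hfin.biUnion (t := fun p => {z | p ≠ 0 ∧ Polynomial.aeval z p = 0}) ?_).subset ?_
  · intro p _
    by_cases hp : p = 0
    · simp [hp]
    · refine (p.rootSet_finite Qbar).subset fun z hz => ?_
      rw [Polynomial.mem_rootSet]
      exact hz
  · intro z hz
    have hint : IsIntegral K z := Algebra.IsIntegral.isIntegral z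
    refine Set.mem_biUnion ⟨hz.1, fun j => ?_⟩ ⟨minpoly.ne_zero hint, minpoly.aeval _ _⟩
    set p := (minpoly K z).map (algebraMap K Qbar) with hp
    have hmon : p.Monic := (minpoly.monic hint).map _
    have hprod := (IsAlgClosed.splits p).eq_prod_roots
    rw [hmon.leadingCoeff, Polynomial.C_1, one_mul] at hprod
    have hcard : Multiset.card p.roots ≤ D := by
      refine (Polynomial.card_roots' p).trans ?_
      rw [hp, Polynomial.natDegree_map]
      exact hz.1
    have hroots : ∀ a ∈ p.roots, absLogHeight₁ a ≤ B := by
      intro a ha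
      have ha' : IsConjRoot K z a := by
        rw [isConjRoot_iff_aeval_eq_zero hint]
        rw [Polynomial.mem_roots hmon.ne_zero, Polynomial.IsRoot, hp, Polynomial.eval_map] at ha
        exact ha
      obtain ⟨σ, rfl⟩ := ha'.exists_algEquiv
      have := absLogHeight₁_ringHom (σ : Qbar →+* Qbar) a
      exact this.symm.trans_le hz.2
    have h := absLogHeight₁_coeff_prod_le p.roots hroots j
    rw [← hprod, hp, Polynomial.coeff_map] at h
    refine h.trans (mul_le_mul_of_nonneg_right ?_ (by positivity))
    gcongr
    norm_num

theorem PropertyN.propertyPbar {K : IntermediateField ℚ Qbar} (hK : PropertyN (K : Set Qbar)) :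
    PropertyPbar K := by
  intro f hf X ⟨D, hD⟩ hX
  obtain ⟨e⟩ := nonempty_algEquiv_algebraicClosure K Qbar
  obtain ⟨C, hC⟩ := exists_mul_absLogHeight₁_le
    (P := f.map (e : AlgebraicClosure K →+* Qbar)) (Q := 1) isCoprime_one_right
  have hg : ∀ x ∈ X, ∃ y ∈ X, f.eval y = x := fun x hx => hX hx
  choose! g hgX hg using hg
  have hd : (2 : ℝ) ≤ f.natDegree := by exact_mod_cast hf
  refine finite_of_contracting (fun x => absLogHeight₁ (e x)) X (fun B => ?_) g hgX
    (fun x hx y hy hxy => by rw [← hg x hx, ← hg y hy, hxy])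
    (c := 1 / f.natDegree) (C := C / f.natDegree) (by positivity)
    ((div_lt_one (by positivity)).2 (by linarith)) fun x hx => ?_
  · refine Set.Finite.of_finite_image (f := e)
      ((hK.finite_of_natDegree_minpoly_le D B).subset ?_) e.injective.injOn
    rintro _ ⟨x, hx, rfl⟩
    refine ⟨?_, hx.2⟩
    rw [minpoly.algEquiv_eq]
    exact hD x hx.1
  · have h := hC (e (g x)) (by simp)
    rw [Polynomial.natDegree_one, Nat.max_zero, Polynomial.natDegree_map] at h
    have h2 : (f.map (e : AlgebraicClosure K →+* Qbar)).eval (e (g x)) = e x := by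
      conv_rhs => rw [← hg x hx]
      exact Polynomial.eval_map_apply (e : AlgebraicClosure K →+* Qbar) (g x)
    rw [h2, Polynomial.eval_one, div_one] at h
    rw [div_mul_eq_mul_div, ← add_div, le_div_iff₀ (by positivity)]
    linarith

theorem PropertyN.propertyR {K : IntermediateField ℚ Qbar} (hK : PropertyN (K : Set Qbar)) :
    PropertyR K := by
  rintro f ⟨X, hXinf, hpole, hX⟩
  by_cases hd : max f.num.natDegree f.denom.natDegree ≤ 1
  · obtain ⟨a, b, hab⟩ := Polynomial.exists_eq_X_add_C_of_natDegree_le_one ((le_max_left _ _).trans hd)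
    obtain ⟨c, d, hcd⟩ := Polynomial.exists_eq_X_add_C_of_natDegree_le_one ((le_max_right _ _).trans hd)
    refine ⟨a, b, c, d, ?_, ?_⟩
    · by_contra! h
      exact f.denom_ne_zero (by rw [hcd, h.1, h.2]; simp)
    · conv_lhs => rw [← f.num_div_denom, hab, hcd]
      simp
  · refine absurd ?_ hXinf
    set φ := algebraMap K Qbar
    obtain ⟨C, hC⟩ := exists_mul_absLogHeight₁_le (P := f.num.map φ) (Q := f.denom.map φ)
      (f.isCoprime_num_denom.map (Polynomial.mapRingHom φ))
    simp only [Polynomial.natDegree_map] at hC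
    set d := max f.num.natDegree f.denom.natDegree
    have hd2 : (2 : ℝ) ≤ d := by exact_mod_cast not_le.1 hd
    have hg : ∀ x ∈ X, ∃ y ∈ X, f.eval (RingHom.id K) y = x := fun x hx => hX.ge hx
    choose! g hgX hg using hg
    refine finite_of_contracting (fun x : K => absLogHeight₁ (x : Qbar)) X
      (fun B => (hK.finite_le B).subset fun x hx => hx.2) g hgX
      (fun x hx y hy hxy => by rw [← hg x hx, ← hg y hy, hxy])
      (c := 1 / d) (C := C / d) (by positivity)
      ((div_lt_one (by positivity)).2 (by linarith)) fun x hx => ?_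
    have heval (p : Polynomial K) (y : K) : (p.map φ).eval (y : Qbar) = (p.eval y : K) :=
      Polynomial.eval_map_apply φ y
    have h := hC (g x : Qbar) (by
      rw [heval]
      exact_mod_cast hpole _ (hgX x hx))
    have h2 : (f.num.map φ).eval (g x : Qbar) / (f.denom.map φ).eval (g x : Qbar) = (x : Qbar) := by
      conv_rhs => rw [← hg x hx]
      rw [heval, heval, RatFunc.eval]
      push_cast
      rfl
    rw [h2] at h
    rw [div_mul_eq_mul_div, ← add_div, le_div_iff₀ (by positivity)]
    linarith

/-! ### Construction of the two towers. -/

instance isGalois_Qbar : IsGalois ℚ Qbar :=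
  have : Normal ℚ Qbar := normal_iff.2 fun x =>
    ⟨Algebra.IsIntegral.isIntegral x, IsAlgClosed.splits _⟩
  ⟨⟩

theorem natCast_prime_mul_pow_ne {p q d : ℕ} (hp : p.Prime) (hq : q.Prime) (hpq : p ≠ q)
    (hd : 2 ≤ d) (r : ℚ) : (q : ℚ) * r ^ d ≠ p := by
  intro h
  have := Fact.mk hp
  have := Fact.mk hq
  have hr : r ≠ 0 := by
    rintro rfl
    rw [zero_pow (by omega), mul_zero] at h
    exact hp.ne_zero (by exact_mod_cast h.symm)
  have h1 := congrArg (padicValRat p) h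
  rw [padicValRat.mul (by exact_mod_cast hq.ne_zero) (pow_ne_zero _ hr), padicValRat.pow,
    padicValRat.self hp.one_lt, padicValRat.of_nat, padicValNat_primes hpq] at h1
  have h2 : (d : ℤ) ∣ 1 := ⟨_, by simpa using h1.symm⟩
  have := Int.le_of_dvd one_pos h2
  omega

/-- A number field contains a `d`-th root of only finitely many primes. -/
theorem finite_primes_with_root (F : IntermediateField ℚ Qbar) [FiniteDimensional ℚ F] {d : ℕ}
    (hd : 2 ≤ d) : {p : ℕ | p.Prime ∧ ∃ x ∈ F, x ^ d = (p : Qbar)}.Finite := by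
  have hx : ∀ p ∈ {p : ℕ | p.Prime ∧ ∃ x ∈ F, x ^ d = (p : Qbar)}, ∃ x : F, x ^ d = (p : F) := by
    rintro p ⟨-, x, hx, hxp⟩
    exact ⟨⟨x, hx⟩, Subtype.ext (by simpa using hxp)⟩
  choose! x hx using hx
  have hx0 : ∀ p ∈ {p : ℕ | p.Prime ∧ ∃ x ∈ F, x ^ d = (p : Qbar)}, (x p : Qbar) ≠ 0 := by
    intro p hp h0
    have h1 := hx p hp
    rw [ZeroMemClass.coe_eq_zero.1 h0, zero_pow (by omega)] at h1
    exact hp.1.ne_zero (by exact_mod_cast h1.symm)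
  have hroots : {ζ : Qbar | ζ ^ d = 1}.Finite := by
    refine (Polynomial.nthRootsFinset d (1 : Qbar)).finite_toSet.subset fun ζ hζ => ?_
    exact (Polynomial.mem_nthRootsFinset (by omega) _).2 hζ
  -- Each prime is encoded by the function $\sigma\mapsto\sigma(x_p)/x_p$ on the finitely many
  -- embeddings, with values in the $d$-th roots of unity.
  refine Set.Finite.of_finite_image
    (f := fun p => fun σ : F →ₐ[ℚ] Qbar => σ (x p) / (x p : Qbar))
    ((Set.Finite.pi' fun _ => hroots).subset ?_) ?_
  · rintro _ ⟨p, hp, rfl⟩ σ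
    have h1 : (x p : Qbar) ^ d = p := by simpa using congrArg F.val (hx p hp)
    have h2 : σ (x p) ^ d = p := by rw [← map_pow, hx p hp, map_natCast]
    have h3 : (p : Qbar) ≠ 0 := by exact_mod_cast hp.1.ne_zero
    change (σ (x p) / (x p : Qbar)) ^ d = 1
    rw [div_pow, h1, h2, div_self h3]
  · intro p hp q hq hpq
    by_contra hne
    -- Equal codes make $x_p/x_q$ Galois invariant, hence rational, so $p/q$ would be a rational
    -- $d$-th power.
    have hfix : ∀ τ : Qbar ≃ₐ[ℚ] Qbar, τ ((x p : Qbar) / x q) = (x p : Qbar) / x q := by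
      intro τ
      have h1 : τ (x p) / (x p : Qbar) = τ (x q) / (x q : Qbar) :=
        congrFun hpq ((τ : Qbar →ₐ[ℚ] Qbar).comp F.val)
      have h2 := hx0 p hp
      have h3 := hx0 q hq
      have h4 : τ (x q) ≠ 0 := τ.map_ne_zero_iff.2 h3
      rw [map_div₀]
      field_simp at h1 ⊢
      exact h1
    obtain ⟨r, hr⟩ := (InfiniteGalois.mem_bot_iff_fixed _).2 hfix
    refine natCast_prime_mul_pow_ne hp.1 hq.1 hne hd r ?_
    have h1 : (x p : Qbar) ^ d = p := by simpa using congrArg F.val (hx p hp)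
    have h2 : (x q : Qbar) ^ d = q := by simpa using congrArg F.val (hx q hq)
    have h3 : (x p : Qbar) = x q * algebraMap ℚ Qbar r := by
      change algebraMap ℚ Qbar r = _ at hr
      rw [hr, mul_div_cancel₀ _ (hx0 q hq)]
    rw [h3, mul_pow, h2, ← map_pow] at h1
    exact (algebraMap ℚ Qbar).injective (by simpa using h1)

theorem propertyN_of_finiteDimensional (K : IntermediateField ℚ Qbar) [FiniteDimensional ℚ K] :
    PropertyN (K : Set Qbar) := by
  intro T _
  have : NumberField K := {}
  refine ((finite_setOfPred_logHeight₁_le K (T * Module.finrank ℚ K)).image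
    ((↑) : K → Qbar)).subset ?_
  rintro x ⟨hx, hxT⟩
  refine ⟨⟨x, hx⟩, ?_, rfl⟩
  have h := absLogHeight₁_eq_logHeight₁ (⟨x, hx⟩ : K)
  have hK : (0 : ℝ) < Module.finrank ℚ K := by exact_mod_cast Module.finrank_pos
  rw [eq_div_iff hK.ne'] at h
  exact h.symm.trans_le (mul_le_mul_of_nonneg_right hxT.le hK.le)

open IntermediateField in
theorem mem_adjoin_of_prime_finrank {K E : Type*} [Field K] [Field E] [Algebra K E] {u α : E}
    (hu : IsIntegral K u) (hp : (Module.finrank K K⟮u⟯).Prime) (hα : α ∈ K⟮u⟯)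
    (hαK : α ∉ (⊥ : IntermediateField K E)) : u ∈ K⟮α⟯ := by
  have : FiniteDimensional K K⟮u⟯ := adjoin.finiteDimensional hu
  have hle : K⟮α⟯ ≤ K⟮u⟯ := by rwa [adjoin_simple_le_iff]
  have h := finrank_dvd_of_le_right hle
  rcases (Nat.dvd_prime hp).1 h with h1 | h1
  · rw [finrank_adjoin_simple_eq_one_iff] at h1
    exact absurd h1 hαK
  · rw [eq_of_le_of_finrank_eq hle h1]
    exact mem_adjoin_simple_self K u

open IntermediateField in
-- Unless `K` already has a $d$-th root of $p$, the degree of $K(u)/K$ is the prime $d$, so a new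
-- `α` generates it and $u\in K(\alpha)$. Only finitely many `α` have this height and degree, and
-- each $K(\alpha)$ has $d$-th roots of finitely many primes.
theorem finite_primes_with_small_height (K : IntermediateField ℚ Qbar) [FiniteDimensional ℚ K]
    {d : ℕ} (hd : d.Prime) (T : ℝ) :
    {p : ℕ | p.Prime ∧ ∃ u : Qbar, u ^ d = p ∧ ∃ α ∈ K⟮u⟯, absLogHeight₁ α < T ∧ α ∉ K}.Finite := by
  have hS := (propertyN_of_finiteDimensional K).finite_of_natDegree_minpoly_le d T
  have hfd (α : Qbar) : FiniteDimensional ℚ ((K⟮α⟯).restrictScalars ℚ) := by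
    have : FiniteDimensional K K⟮α⟯ := adjoin.finiteDimensional (Algebra.IsIntegral.isIntegral α)
    exact Module.Finite.trans (R := ℚ) K K⟮α⟯
  refine ((finite_primes_with_root K hd.two_le).union (hS.biUnion fun α _ =>
    finite_primes_with_root ((K⟮α⟯).restrictScalars ℚ) hd.two_le)).subset ?_
  rintro p ⟨hp, u, hu, α, hα, hαT, hαK⟩
  by_cases hroot : ∃ x ∈ K, x ^ d = (p : Qbar)
  · exact .inl ⟨hp, hroot⟩
  have hirr : Irreducible (Polynomial.X ^ d - Polynomial.C (p : K)) :=
    X_pow_sub_C_irreducible_of_prime hd fun b hb => hroot ⟨b, b.2, by simpa using congrArg K.val hb⟩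
  have huint : IsIntegral K u := Algebra.IsIntegral.isIntegral u
  have hmin : minpoly K u = Polynomial.X ^ d - Polynomial.C (p : K) :=
    (minpoly.eq_of_irreducible_of_monic hirr (by simp [hu])
      (Polynomial.monic_X_pow_sub_C _ hd.ne_zero)).symm
  have hfr : Module.finrank K K⟮u⟯ = d := by
    rw [adjoin.finrank huint, hmin, Polynomial.natDegree_X_pow_sub_C]
  have hmem : u ∈ K⟮α⟯ := mem_adjoin_of_prime_finrank huint (hfr ▸ hd) hα fun h => hαK (by
    obtain ⟨a, rfl⟩ := mem_bot.1 h
    exact a.2)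
  have : FiniteDimensional K K⟮u⟯ := adjoin.finiteDimensional huint
  refine .inr (Set.mem_biUnion ⟨?_, hαT.le⟩ ⟨hp, u, hmem, hu⟩)
  rw [← adjoin.finrank (Algebra.IsIntegral.isIntegral α), ← hfr]
  exact finrank_le_of_le_right (by rwa [adjoin_simple_le_iff])

open IntermediateField in
theorem exists_extension_step (K₁ K₂ : IntermediateField ℚ Qbar) [FiniteDimensional ℚ K₁]
    [FiniteDimensional ℚ K₂] {d : ℕ} (hd : d.Prime) (T : ℝ) :
    ∃ M₁ M₂ : IntermediateField ℚ Qbar, FiniteDimensional ℚ M₁ ∧ FiniteDimensional ℚ M₂ ∧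
      K₁ ≤ M₁ ∧ K₂ ≤ M₂ ∧ (∀ α ∈ M₁, absLogHeight₁ α < T → α ∈ K₁) ∧
      (∀ α ∈ M₂, absLogHeight₁ α < T → α ∈ K₂) ∧ ∃ ζ ∈ M₁ ⊔ M₂, IsPrimitiveRoot ζ d := by
  obtain ⟨p, hp, hpS⟩ := (Nat.infinite_setOfPred_prime.sdiff
    ((finite_primes_with_small_height K₁ hd T).union
      (finite_primes_with_small_height K₂ hd T))).nonempty
  obtain ⟨u, hu⟩ := IsAlgClosed.exists_pow_nat_eq (p : Qbar) hd.pos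
  have : NeZero (d : Qbar) := ⟨by exact_mod_cast hd.ne_zero⟩
  obtain ⟨ζ, hζ⟩ := HasEnoughRootsOfUnity.exists_primitiveRoot Qbar d
  have hv : (ζ * u) ^ d = p := by rw [mul_pow, hζ.pow_eq_one, hu, one_mul]
  have hu0 : u ≠ 0 := by
    rintro rfl
    rw [zero_pow hd.ne_zero] at hu
    exact hp.ne_zero (by exact_mod_cast hu.symm)
  have hfd (K : IntermediateField ℚ Qbar) [FiniteDimensional ℚ K] (α : Qbar) :
      FiniteDimensional ℚ ((K⟮α⟯).restrictScalars ℚ) := by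
    have : FiniteDimensional K K⟮α⟯ := adjoin.finiteDimensional (Algebra.IsIntegral.isIntegral α)
    exact Module.Finite.trans (R := ℚ) K K⟮α⟯
  have hle (K : IntermediateField ℚ Qbar) (α : Qbar) : K ≤ (K⟮α⟯).restrictScalars ℚ :=
    fun a ha => (K⟮α⟯).algebraMap_mem ⟨a, ha⟩
  refine ⟨(K₁⟮u⟯).restrictScalars ℚ, (K₂⟮ζ * u⟯).restrictScalars ℚ, hfd _ _, hfd _ _, hle _ _,
    hle _ _, fun α hα hαT => ?_, fun α hα hαT => ?_, ζ, ?_, hζ⟩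
  · by_contra h
    exact hpS (.inl ⟨hp, u, hu, α, hα, hαT, h⟩)
  · by_contra h
    exact hpS (.inr ⟨hp, ζ * u, hv, α, hα, hαT, h⟩)
  · have h1 : u ∈ (K₁⟮u⟯).restrictScalars ℚ ⊔ (K₂⟮ζ * u⟯).restrictScalars ℚ :=
      (le_sup_left : (K₁⟮u⟯).restrictScalars ℚ ≤ _) (mem_adjoin_simple_self K₁ u)
    have h2 : ζ * u ∈ (K₁⟮u⟯).restrictScalars ℚ ⊔ (K₂⟮ζ * u⟯).restrictScalars ℚ :=
      (le_sup_right : (K₂⟮ζ * u⟯).restrictScalars ℚ ≤ _) (mem_adjoin_simple_self K₂ (ζ * u))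
    have h3 := div_mem h2 h1
    rwa [mul_div_cancel_right₀ _ hu0] at h3

/-- Elements of height below `T` stop appearing after stage `N ≥ T`, so they all lie in one number
field. -/
theorem propertyN_iSup {K : ℕ → IntermediateField ℚ Qbar} (hfd : ∀ n, FiniteDimensional ℚ (K n))
    (hmono : Monotone K) (hK : ∀ n : ℕ, ∀ α ∈ K (n + 1), absLogHeight₁ α < n → α ∈ K n) :
    PropertyN ((⨆ n, K n : IntermediateField ℚ Qbar) : Set Qbar) := by
  intro T hT
  obtain ⟨N, hN⟩ := exists_nat_ge T
  refine (propertyN_of_finiteDimensional (K N) T hT).subset ?_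
  rintro x ⟨hx, hxT⟩
  refine ⟨?_, hxT⟩
  rw [IntermediateField.coe_iSup_of_directed hmono.directed_le, Set.mem_iUnion] at hx
  obtain ⟨n, hn⟩ := hx
  rcases le_total n N with h | h
  · exact hmono h hn
  · induction n, h using Nat.le_induction with
    | base => exact hn
    | succ n h ih =>
      exact ih (hK n x hn (hxT.trans_le (hN.trans (by exact_mod_cast h))))

theorem exists_propertyN_pair :
    ∃ L₁ L₂ : IntermediateField ℚ Qbar, PropertyN (L₁ : Set Qbar) ∧ PropertyN (L₂ : Set Qbar) ∧
      ∀ n : ℕ, ∃ d ≥ n, d.Prime ∧ ∃ ζ ∈ L₁ ⊔ L₂, IsPrimitiveRoot ζ d := by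
  let S := {P : IntermediateField ℚ Qbar × IntermediateField ℚ Qbar //
    FiniteDimensional ℚ P.1 ∧ FiniteDimensional ℚ P.2}
  have step (n : ℕ) (P : S) : ∃ Q : S, P.1.1 ≤ Q.1.1 ∧ P.1.2 ≤ Q.1.2 ∧
      (∀ α ∈ Q.1.1, absLogHeight₁ α < n → α ∈ P.1.1) ∧
      (∀ α ∈ Q.1.2, absLogHeight₁ α < n → α ∈ P.1.2) ∧
      ∃ d ≥ n, d.Prime ∧ ∃ ζ ∈ Q.1.1 ⊔ Q.1.2, IsPrimitiveRoot ζ d := by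
    obtain ⟨⟨K₁, K₂⟩, h₁, h₂⟩ := P
    obtain ⟨d, hdn, hd⟩ := Nat.exists_infinite_primes n
    obtain ⟨M₁, M₂, f₁, f₂, l₁, l₂, t₁, t₂, hζ⟩ := exists_extension_step K₁ K₂ hd n
    exact ⟨⟨(M₁, M₂), f₁, f₂⟩, l₁, l₂, t₁, t₂, d, hdn, hd, hζ⟩
  choose next h₁ h₂ t₁ t₂ hζ using step
  -- Both towers start at $\mathbb{Q}$; stage `n` uses height threshold `n` and a prime `d ≥ n`.
  let P (n : ℕ) : S := n.rec
    ⟨(⊥, ⊥), inferInstanceAs (FiniteDimensional ℚ (⊥ : IntermediateField ℚ Qbar)),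
      inferInstanceAs (FiniteDimensional ℚ (⊥ : IntermediateField ℚ Qbar))⟩
    next
  have m₁ : Monotone fun n => (P n).1.1 := monotone_nat_of_le_succ fun n => h₁ n (P n)
  have m₂ : Monotone fun n => (P n).1.2 := monotone_nat_of_le_succ fun n => h₂ n (P n)
  refine ⟨⨆ n, (P n).1.1, ⨆ n, (P n).1.2,
    propertyN_iSup (fun n => (P n).2.1) m₁ fun n => t₁ n (P n),
    propertyN_iSup (fun n => (P n).2.2) m₂ fun n => t₂ n (P n), fun n => ?_⟩
  obtain ⟨d, hdn, hd, ζ, hζ, hζd⟩ := hζ n (P n)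
  refine ⟨d, hdn, hd, ζ, ?_, hζd⟩
  exact sup_le_sup (le_iSup (fun n => (P n).1.1) (n + 1)) (le_iSup (fun n => (P n).1.2) (n + 1)) hζ

/-! ### Failure of the six properties in the compositum. -/

/-- The roots of unity of odd order. -/
def oddRootsOfUnity (k : Type*) [Field k] : Set k := {ζ | ∃ n, Odd n ∧ ζ ^ n = 1}

section
variable {k : Type*} [Field k]

theorem sq_image_oddRootsOfUnity : (fun x => x ^ 2) '' oddRootsOfUnity k = oddRootsOfUnity k := by
  ext x
  constructor
  · rintro ⟨y, ⟨n, hn, hy⟩, rfl⟩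
    exact ⟨n, hn, by rw [← pow_mul, mul_comm, pow_mul, hy, one_pow]⟩
  · rintro ⟨n, ⟨m, rfl⟩, hx⟩
    -- If $x^{2m+1}=1$, then $x^{m+1}$ is a square root of $x$.
    refine ⟨x ^ (m + 1), ⟨2 * m + 1, ⟨m, rfl⟩, by rw [← pow_mul, mul_comm, pow_mul, hx, one_pow]⟩, ?_⟩
    change (x ^ (m + 1)) ^ 2 = x
    rw [← pow_mul, show (m + 1) * 2 = (2 * m + 1) + 1 by ring, pow_succ, hx, one_mul]

theorem infinite_oddRootsOfUnity
    (h : ∀ n : ℕ, ∃ d ≥ n, d.Prime ∧ ∃ ζ : k, IsPrimitiveRoot ζ d) :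
    (oddRootsOfUnity k).Infinite := by
  refine Set.Infinite.of_image orderOf (Set.infinite_of_forall_exists_gt fun n => ?_)
  -- The shift by `3` excludes the prime `2` and makes the order exceed `n`.
  obtain ⟨d, hdn, hd, ζ, hζ⟩ := h (n + 3)
  exact ⟨d, ⟨ζ, ⟨d, hd.odd_of_ne_two (by omega), hζ.pow_eq_one⟩, hζ.eq_orderOf.symm⟩, by omega⟩

theorem isPreperiodicPt_sq_of_mem_oddRootsOfUnity {x : k} (hx : x ∈ oddRootsOfUnity k) :
    IsPreperiodicPt (fun y => y ^ 2) x := by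
  obtain ⟨n, hn, hx⟩ := hx
  -- Euler's theorem, $2^{\varphi(n)}\equiv 1 \pmod n$, makes the point periodic.
  refine ⟨0, n.totient, Nat.totient_pos.2 hn.pos, ?_⟩
  rw [Function.iterate_zero, id, pow_iterate]
  change x = x ^ 2 ^ n.totient
  have h := Nat.ModEq.pow_totient hn.coprime_two_left
  rw [← pow_mod_orderOf, (h.of_dvd (orderOf_dvd_of_pow_eq_one hx) : _ % _ = _ % _),
    pow_mod_orderOf, pow_one]

theorem not_propertyP (hk : (oddRootsOfUnity k).Infinite) : ¬ PropertyP k := by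
  intro h
  have hlead : leadingForm (MvPolynomial.X 0 ^ 2 : MvPolynomial (Fin 1) k) = MvPolynomial.X 0 ^ 2 := by
    rw [leadingForm, MvPolynomial.totalDegree_X_pow,
      MvPolynomial.homogeneousComponent_of_mem (MvPolynomial.isHomogeneous_X_pow _ _), if_pos rfl]
  have hfin := h (fun _ => MvPolynomial.X 0 ^ 2)
    ⟨fun _ => (MvPolynomial.totalDegree_X_pow _ _).ge, fun y hy => by
      ext i
      have := hy 0
      rw [hlead] at this
      rw [Subsingleton.elim i 0]
      simpa using this⟩
    ((fun x _ => x) '' oddRootsOfUnity k) (by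
      conv_rhs => rw [← sq_image_oddRootsOfUnity]
      rw [Set.image_image, Set.image_image]
      refine Set.image_congr fun x _ => ?_
      ext i
      simp [polyMap])
  exact hk (hfin.of_finite_image fun x _ y _ hxy => congrFun hxy 0)

theorem not_propertyPbar (hk : (oddRootsOfUnity k).Infinite) : ¬ PropertyPbar k := by
  intro h
  have hfin := h (Polynomial.X ^ 2) (Polynomial.natDegree_X_pow 2).ge
    (algebraMap k (AlgebraicClosure k) '' oddRootsOfUnity k) ⟨1, by
      rintro _ ⟨x, -, rfl⟩
      rw [minpoly.eq_X_sub_C, Polynomial.natDegree_X_sub_C]⟩ (by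
      conv_lhs => rw [← sq_image_oddRootsOfUnity]
      rw [Set.image_image, Set.image_image]
      refine (Set.image_congr fun x _ => ?_).subset
      simp)
  exact hk (hfin.of_finite_image (algebraMap k (AlgebraicClosure k)).injective.injOn)

theorem not_propertyR (hk : (oddRootsOfUnity k).Infinite) : ¬ PropertyR k := by
  intro h
  have hX : (RatFunc.X ^ 2 : RatFunc k) = algebraMap (Polynomial k) _ (Polynomial.X ^ 2) := by simp
  obtain ⟨a, b, c, d, hcd, hf⟩ := h (RatFunc.X ^ 2) ⟨oddRootsOfUnity k, hk, fun x _ => by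
      rw [hX, RatFunc.denom_algebraMap]; simp, by
      conv_rhs => rw [← sq_image_oddRootsOfUnity]
      refine Set.image_congr fun x _ => ?_
      rw [hX, RatFunc.eval_algebraMap]; simp⟩
  have hden : (RatFunc.C c * RatFunc.X + RatFunc.C d : RatFunc k) =
      algebraMap (Polynomial k) _ (Polynomial.C c * Polynomial.X + Polynomial.C d) := by simp
  have hnum : (RatFunc.C a * RatFunc.X + RatFunc.C b : RatFunc k) =
      algebraMap (Polynomial k) _ (Polynomial.C a * Polynomial.X + Polynomial.C b) := by simp
  have hne : Polynomial.C c * Polynomial.X + Polynomial.C d ≠ 0 := by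
    intro h0
    have h1 := congrArg (fun p => Polynomial.coeff p 0) h0
    have h2 := congrArg (fun p => Polynomial.coeff p 1) h0
    simp [Polynomial.coeff_C] at h1 h2
    tauto
  rw [hden, hnum, hX, eq_div_iff (RatFunc.algebraMap_ne_zero hne), ← map_mul] at hf
  have hp := RatFunc.algebraMap_injective k hf
  -- In $X^2(cX+d)=aX+b$ the coefficients of degrees 2 and 3 give $d=c=0$.
  have h2 := congrArg (fun p => Polynomial.coeff p 2) hp
  have h3 := congrArg (fun p => Polynomial.coeff p 3) hp
  simp only [Polynomial.coeff_X_pow_mul' , Polynomial.coeff_add, Polynomial.coeff_C_mul,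
    Polynomial.coeff_X, Polynomial.coeff_C] at h2 h3
  norm_num at h2 h3
  tauto

end

theorem absLogHeight₁_pow (x : Qbar) (n : ℕ) : absLogHeight₁ (x ^ n) = n * absLogHeight₁ x := by
  rw [absLogHeight₁_eq_tupleHeight, absLogHeight₁_eq_tupleHeight, ← tupleHeight_pow]
  congr 1
  ext i; fin_cases i <;> simp

theorem not_propertyN {K : IntermediateField ℚ Qbar} (hK : (oddRootsOfUnity K).Infinite) :
    ¬ PropertyN (K : Set Qbar) := by
  intro h
  refine hK ((h.finite_le 0).subset ?_)
  rintro x ⟨n, hn, hx⟩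
  have h1 := absLogHeight₁_pow (x : Qbar) n
  have h2 : (x : Qbar) ^ n = 1 := by simpa using congrArg K.val hx
  rw [h2, absLogHeight₁_one, eq_comm, mul_eq_zero] at h1
  exact (h1.resolve_left (by exact_mod_cast hn.pos.ne')).le

end

theorem mainTheorem10 :
    ∃ L₁ L₂ : IntermediateField ℚ Qbar,
      (PropertyN (L₁ : Set Qbar) ∧ PropertyK L₁ ∧ PropertySP L₁ ∧ PropertyPbar L₁ ∧
        PropertyR L₁ ∧ PropertyP L₁) ∧
      (PropertyN (L₂ : Set Qbar) ∧ PropertyK L₂ ∧ PropertySP L₂ ∧ PropertyPbar L₂ ∧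
        PropertyR L₂ ∧ PropertyP L₂) ∧
      {ζ : ↥(L₁ ⊔ L₂) | ∃ n : ℕ, 0 < n ∧ ζ ^ n = 1}.Infinite ∧
      {x : ↥(L₁ ⊔ L₂) | IsPreperiodicPt (fun y => y ^ 2) x}.Infinite ∧
      ¬ PropertyN ((L₁ ⊔ L₂ : IntermediateField ℚ Qbar) : Set Qbar) ∧
      ¬ PropertyK ↥(L₁ ⊔ L₂) ∧
      ¬ PropertySP ↥(L₁ ⊔ L₂) ∧
      ¬ PropertyPbar ↥(L₁ ⊔ L₂) ∧
      ¬ PropertyR ↥(L₁ ⊔ L₂) ∧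
      ¬ PropertyP ↥(L₁ ⊔ L₂) := by
  obtain ⟨L₁, L₂, h₁, h₂, h⟩ := exists_propertyN_pair
  have hinf : (oddRootsOfUnity ↥(L₁ ⊔ L₂)).Infinite := infinite_oddRootsOfUnity fun n => by
    obtain ⟨d, hdn, hd, ζ, hζ, hζd⟩ := h n
    exact ⟨d, hdn, hd, ⟨ζ, hζ⟩,
      IsPrimitiveRoot.of_map_of_injective (f := (L₁ ⊔ L₂).val) hζd Subtype.val_injective⟩
  have all {L : IntermediateField ℚ Qbar} (hL : PropertyN (L : Set Qbar)) :
      PropertyN (L : Set Qbar) ∧ PropertyK L ∧ PropertySP L ∧ PropertyPbar L ∧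
        PropertyR L ∧ PropertyP L :=
    ⟨hL, hL.propertyK, hL.propertyK.propertySP, hL.propertyPbar, hL.propertyR,
      hL.propertyK.propertySP.propertyP⟩
  have hP := not_propertyP hinf
  exact ⟨L₁, L₂, all h₁, all h₂,
    hinf.mono (by rintro ζ ⟨n, hn, hζ⟩; exact ⟨n, hn.pos, hζ⟩),
    hinf.mono (fun x hx => isPreperiodicPt_sq_of_mem_oddRootsOfUnity hx),
    not_propertyN hinf, fun hK => hP hK.propertySP.propertyP, fun hSP => hP hSP.propertyP,
    not_propertyPbar hinf, not_propertyR hinf, hP⟩
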